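/- Let $X$ be a non-empty compact metric space and let $\mathcal{K}(X)$ be the set of non-empty compact subsets of $X$, equipped with the Hausdorff metric. For $E\subseteq X$ and $r>0$ let $N(E,r)$ be the minimal number of closed balls of radius $r$ (with centres in $X$) needed to cover $E$, and for $F\in\mathcal{K}(X)$ let the lower dimension of $F$ be $$\dim_{\mathrm L}F=\sup\Big\{\alpha\in\mathbb{R} : (\exists C>0)(\exists\rho>0)(\forall\, 0<r<R\le\rho)(\forall x\in F)\ \ N\big(\overline{B}(x,R)\cap F,r\big)\ge C\Big(\frac Rr\Big)^{\alpha}\Big\}\in[0,\infty],$$ where $\overline{B}(x,R)$ is the closed ball with centre $x$ and radius $R$. A function between metrizable spaces is of Baire class $0$ if it is continuous, and of Baire class $n+1$ if it is a pointwise limit of a sequence of functions of Baire class $n$. Then the function $F\mapsto\dim_{\mathrm L}F$ from $\mathcal{K}(X)$ to the extended real line $[-\infty,\infty]$ (with its usual topology) is of Baire class $2$. Moreover, if $\dim_{\mathrm L}F<\infty$ for every $F\in\mathcal{K}(X)$, then $F\mapsto\dim_{\mathrm L}F$ is of Baire class $2$ as a function from $\mathcal{K}(X)$ to $\mathbb{R}$.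 -/

import Mathlib

open Filter Topology TopologicalSpace
open scoped ENNReal

/-- The lower dimension `dim_L F` of a subset `F` of a metric space `X`: the supremum, in the extended
reals, of the real exponents `α` for which there are `C > 0` and `ρ > 0` such that for all
`0 < r < R ≤ ρ` and all `x ∈ F` one has `N(B(x, R) ∩ F, r) ≥ C (R / r) ^ α`. Here `N(E, r)` is the
minimal number of balls of radius `r` (with centres anywhere in `X`) needed to cover `E`.
For nonempty `F` every `α ≤ 0` is admissible, so the value lies in `[0, ∞]`. -/
noncomputable def lowerDimension {X : Type*} [MetricSpace X] (F : Set X) : EReal :=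
  sSup {a : EReal | ∃ α : ℝ, a = (α : EReal) ∧
    ∃ C : ℝ, 0 < C ∧ ∃ ρ : ℝ, 0 < ρ ∧
      ∀ r R : ℝ, 0 < r → r < R → R ≤ ρ → ∀ x ∈ F,
        ENNReal.ofReal (C * (R / r) ^ α) ≤
          ((Metric.externalCoveringNumber r.toNNReal (Metric.closedBall x R ∩ F) : ℕ∞) : ℝ≥0∞)}

/-- The finite levels of the Baire hierarchy: a function is of Baire class `0` if it is continuous,
and of Baire class `n + 1` if it is a pointwise limit of a sequence of functions of Baire
class `n`. -/
def IsBaireClass {A B : Type*} [TopologicalSpace A] [TopologicalSpace B] : ℕ → (A → B) → Prop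
  | 0, f => Continuous f
  | n + 1, f => ∃ g : ℕ → A → B, (∀ k, IsBaireClass n (g k)) ∧
      ∀ x, Tendsto (fun k => g k x) atTop (𝓝 (f x))

section BaireClass

variable {A B D : Type*} [TopologicalSpace A] [TopologicalSpace B] [TopologicalSpace D]

/-! For fixed `α`, `C`, `ρ` the covering estimate defines a closed set of compacta
(`isClosed_hasLowerCoveringBound`). By monotonicity in the parameters, rational `α` and `C = ρ =
1/(m+1)` suffice, so the lower dimension is a supremum of exponents attached to countably many
closed sets. Finite maxima of the corresponding multiples of indicators are of Baire class 1 and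
increase to it. -/

theorem IsBaireClass.continuous_comp {g : B → D} (hg : Continuous g) :
    ∀ {n : ℕ} {f : A → B}, IsBaireClass n f → IsBaireClass n (fun x => g (f x))
  | 0, _, hf => hg.comp hf
  | _ + 1, _, ⟨u, hu, hlim⟩ =>
    ⟨fun k x => g (u k x), fun k => (hu k).continuous_comp hg,
      fun x => (hg.tendsto _).comp (hlim x)⟩

theorem isBaireClass_one_finset_sup' {ι : Type*} {s : Finset ι} (hs : s.Nonempty)
    {f : ι → A → ℝ} (hf : ∀ i ∈ s, IsBaireClass 1 (f i)) :
    IsBaireClass 1 (fun x => s.sup' hs (fun i => f i x)) := by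
  choose! u hu hlim using hf
  exact ⟨fun k x => s.sup' hs (fun i => u i k x),
    fun k => Continuous.finset_sup'_apply hs fun i hi => hu i hi k,
    fun x => Filter.Tendsto.finset_sup'_nhds_apply hs fun i hi => hlim i hi x⟩

end BaireClass

/-- A multiple of the indicator function of a closed set is of Baire class `1`. -/
theorem IsClosed.isBaireClass_one_indicator {A : Type*} [PseudoEMetricSpace A] {S : Set A}
    (hS : IsClosed S) (c : ℝ) : IsBaireClass 1 (S.indicator fun _ => c) := by
  have hpos : ∀ n : ℕ, (0 : ℝ) < 1 / ((n : ℝ) + 1) := fun n => Nat.one_div_pos_of_nat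
  refine ⟨fun k x => c * (thickenedIndicator (hpos k) S x : ℝ), fun k => ?_, fun x => ?_⟩
  · exact continuous_const.mul
      (NNReal.continuous_coe.comp (thickenedIndicator (hpos k) S).continuous)
  · have h := tendsto_pi_nhds.1 (thickenedIndicator_tendsto_indicator_closure hpos
      tendsto_one_div_add_atTop_nhds_zero_nat S) x
    have h' := ((NNReal.continuous_coe.tendsto _).comp h).const_mul c
    rw [hS.closure_eq] at h'
    convert! h' using 2
    by_cases hx : x ∈ S <;> simp [hx]

/-- If `f ≥ 0` is the supremum of the exponents attached to a sequence of closed sets, then `f` is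
a pointwise limit of real functions of Baire class `1`. -/
theorem exists_isBaireClass_one_tendsto {A : Type*} [PseudoEMetricSpace A] {f : A → EReal}
    {S : ℕ → Set A} (hS : ∀ n, IsClosed (S n)) {q : ℕ → ℝ} (hf : ∀ x, 0 ≤ f x)
    (hle : ∀ n, ∀ x ∈ S n, (q n : EReal) ≤ f x)
    (hlt : ∀ x, ∀ b : EReal, 0 ≤ b → b < f x → ∃ n, x ∈ S n ∧ b < q n) :
    ∃ g : ℕ → A → ℝ, (∀ k, IsBaireClass 1 (g k)) ∧
      ∀ x, Tendsto (fun k => ((g k x : ℝ) : EReal)) atTop (𝓝 (f x)) := by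
  have hne : ∀ k : ℕ, (Finset.range (k + 1)).Nonempty := fun k => Finset.nonempty_range_add_one
  let g : ℕ → A → ℝ := fun k x =>
    -- The 0 makes every upper bound of the sequence nonnegative, as `hlt` requires.
    max 0 ((Finset.range (k + 1)).sup' (hne k) fun i => (S i).indicator (fun _ => q i) x)
  have hmono : ∀ x, Monotone fun k => ((g k x : ℝ) : EReal) := fun x k l hkl =>
    EReal.coe_le_coe_iff.2 <| max_le_max le_rfl <|
      Finset.sup'_mono _ (Finset.range_mono (by omega)) _
  refine ⟨g, fun k => ?_, fun x => tendsto_atTop_isLUB (hmono x) ⟨?_, fun b hb => ?_⟩⟩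
  · exact (isBaireClass_one_finset_sup' (hne k)
      fun i _ => (hS i).isBaireClass_one_indicator (q i)).continuous_comp
      (continuous_const.max continuous_id)
  · rintro _ ⟨k, rfl⟩
    obtain h | h := max_choice (0 : ℝ)
      ((Finset.range (k + 1)).sup' (hne k) fun i => (S i).indicator (fun _ => q i) x)
    · simpa only [g, h, EReal.coe_zero] using hf x
    · obtain ⟨i, -, hi⟩ := Finset.exists_mem_eq_sup' (hne k)
        fun i => (S i).indicator (fun _ => q i) x
      simp only [g, h, hi]
      by_cases hx : x ∈ S i
      · simpa [hx] using hle i x hx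
      · simpa [hx] using hf x
  · by_contra! hlt'
    have hb0 : 0 ≤ b := (EReal.coe_nonneg.2 (le_max_left _ _)).trans (hb ⟨0, rfl⟩)
    obtain ⟨n, hn, hbn⟩ := hlt x b hb0 hlt'
    refine absurd (hb ⟨n, rfl⟩) (not_le.2 (hbn.trans_le (EReal.coe_le_coe_iff.2 ?_)))
    refine le_max_of_le_right ?_
    refine le_trans ?_ (Finset.le_sup' (fun i => (S i).indicator (fun _ => q i) x)
      (Finset.self_mem_range_succ n))
    simp [hn]

section LowerDimension

variable {X : Type*} [MetricSpace X]

/-- The lower covering estimate with exponent `α` and constants `C`, `ρ` holds for `F`. -/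
def HasLowerCoveringBound (α C ρ : ℝ) (F : Set X) : Prop :=
  ∀ r R : ℝ, 0 < r → r < R → R ≤ ρ → ∀ x ∈ F,
    ENNReal.ofReal (C * (R / r) ^ α) ≤
      ((Metric.externalCoveringNumber r.toNNReal (Metric.closedBall x R ∩ F) : ℕ∞) : ℝ≥0∞)

theorem HasLowerCoveringBound.mono {α α' C C' ρ ρ' : ℝ} {F : Set X}
    (h : HasLowerCoveringBound α C ρ F) (hα : α' ≤ α) (hC : C' ≤ C) (hC0 : 0 ≤ C) (hρ : ρ' ≤ ρ) :
    HasLowerCoveringBound α' C' ρ' F := by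
  intro r R hr hrR hR x hx
  refine le_trans (ENNReal.ofReal_le_ofReal ?_) (h r R hr hrR (hR.trans hρ) x hx)
  have h1 : 1 ≤ R / r := (one_le_div hr).2 hrR.le
  exact mul_le_mul hC (Real.rpow_le_rpow_of_exponent_le h1 hα) (by positivity) hC0

theorem le_lowerDimension {α C ρ : ℝ} {F : Set X} (hC : 0 < C) (hρ : 0 < ρ)
    (h : HasLowerCoveringBound α C ρ F) : (α : EReal) ≤ lowerDimension F :=
  le_sSup ⟨α, rfl, C, hC, ρ, hρ, h⟩

theorem exists_hasLowerCoveringBound_of_lt {F : Set X} {b : EReal} (h : b < lowerDimension F) :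
    ∃ α : ℝ, b < α ∧ ∃ C : ℝ, 0 < C ∧ ∃ ρ : ℝ, 0 < ρ ∧ HasLowerCoveringBound α C ρ F := by
  obtain ⟨_, ⟨α, rfl, hα⟩, hb⟩ := lt_sSup_iff.1 h
  exact ⟨α, hb, hα⟩

theorem hasLowerCoveringBound_zero (F : Set X) : HasLowerCoveringBound 0 1 1 F := by
  intro r R hr hrR _ x hx
  have hne : (Metric.closedBall x R ∩ F).Nonempty :=
    ⟨x, Metric.mem_closedBall_self (hr.trans hrR).le, hx⟩
  have h := Order.one_le_iff_pos.2
    (Metric.externalCoveringNumber_pos_iff (ε := r.toNNReal).2 hne)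
  rw [Real.rpow_zero, mul_one, ENNReal.ofReal_one]
  exact_mod_cast h

theorem lowerDimension_nonneg (F : Set X) : 0 ≤ lowerDimension F := by
  simpa using le_lowerDimension one_pos one_pos (hasLowerCoveringBound_zero F)

/-- Covering numbers of localised pieces of sets at small Hausdorff distance are comparable. -/
theorem externalCoveringNumber_le_of_hausdorffEDist_lt {F G : Set X} {r R t : ℝ} (hr : 0 ≤ r)
    (ht : 0 < t) (h : Metric.hausdorffEDist F G < ENNReal.ofReal (t / 2)) {x y : X}
    (hxy : dist x y ≤ t / 2) :
    Metric.externalCoveringNumber (r + t).toNNReal (Metric.closedBall y (R - t) ∩ G) ≤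
      Metric.externalCoveringNumber r.toNNReal (Metric.closedBall x R ∩ F) := by
  refine le_iInf₂ fun D hD => Metric.IsCover.externalCoveringNumber_le_encard ?_
  rintro z ⟨hzy, hz⟩
  rw [Metric.hausdorffEDist_comm] at h
  obtain ⟨w, hw, hzw⟩ := Metric.exists_edist_lt_of_hausdorffEDist_lt hz h
  rw [edist_dist, ENNReal.ofReal_lt_ofReal_iff (by positivity)] at hzw
  rw [Metric.mem_closedBall] at hzy
  -- Distance budget: `t/2` from `w` to `z`, `R - t` to `y`, `t/2` to `x`.
  have hwx : w ∈ Metric.closedBall x R := by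
    have h1 := dist_triangle4 w z y x
    rw [dist_comm w z, dist_comm y x] at h1
    rw [Metric.mem_closedBall]
    linarith
  obtain ⟨c, hc, hwc⟩ := hD ⟨hwx, hw⟩
  refine ⟨c, hc, ?_⟩
  change edist w c ≤ ENNReal.ofReal r at hwc
  change edist z c ≤ ENNReal.ofReal (r + t)
  rw [edist_dist, ENNReal.ofReal_le_ofReal_iff (by linarith)]
  rw [edist_dist, ENNReal.ofReal_le_ofReal_iff hr] at hwc
  linarith [dist_triangle z w c]

/-- No continuity of covering numbers is needed: a member `G` within `t/2` of `F` is tested at the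
radii `r + t` and `R - t`, which bounds the covering number of `F` at `r`, `R` from below. That
number does not depend on `t`, and `t → 0` restores the constant. -/
theorem isClosed_hasLowerCoveringBound (α C ρ : ℝ) :
    IsClosed {F : NonemptyCompacts X | HasLowerCoveringBound α C ρ (F : Set X)} := by
  refine isClosed_of_closure_subset fun F hF r R hr hrR hR x hx => ?_
  have hcont : Tendsto (fun t : ℝ => ENNReal.ofReal (C * ((R - t) / (r + t)) ^ α)) (𝓝[>] 0)
      (𝓝 (ENNReal.ofReal (C * (R / r) ^ α))) := by
    have h : ContinuousAt (fun t : ℝ => C * ((R - t) / (r + t)) ^ α) 0 := by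
      refine continuousAt_const.mul (ContinuousAt.rpow_const ?_ (Or.inl ?_))
      · exact (by fun_prop : ContinuousAt (fun t : ℝ => R - t) 0).div (by fun_prop) (by simp [hr.ne'])
      · simpa using ⟨(hr.trans hrR).ne', hr.ne'⟩
    have h' := (ENNReal.continuous_ofReal.tendsto _).comp (h.tendsto.mono_left (nhdsWithin_le_nhds (s := Set.Ioi 0)))
    simpa [Function.comp_def] using h'
  refine le_of_tendsto hcont ?_
  -- This range of `t` keeps `r + t < R - t`.
  filter_upwards [Ioo_mem_nhdsGT (show (0 : ℝ) < (R - r) / 2 by linarith)] with t ht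
  obtain ⟨ht0, ht1⟩ := ht
  obtain ⟨G, hG, hFG⟩ := EMetric.mem_closure_iff.1 hF (ENNReal.ofReal (t / 2)) (by simpa using ht0)
  change Metric.hausdorffEDist (F : Set X) G < _ at hFG
  obtain ⟨y, hy, hxy⟩ := Metric.exists_edist_lt_of_hausdorffEDist_lt hx hFG
  rw [edist_dist, ENNReal.ofReal_lt_ofReal_iff (by positivity)] at hxy
  refine (hG (r + t) (R - t) (by linarith) (by linarith) (by linarith) y hy).trans ?_
  exact_mod_cast externalCoveringNumber_le_of_hausdorffEDist_lt hr.le ht0 hFG hxy.le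

/-- The approximants are real-valued, so one sequence serves both codomains. -/
theorem exists_isBaireClass_one_tendsto_lowerDimension (X : Type*) [MetricSpace X] :
    ∃ g : ℕ → NonemptyCompacts X → ℝ, (∀ k, IsBaireClass 1 (g k)) ∧
      ∀ F : NonemptyCompacts X,
        Tendsto (fun k => ((g k F : ℝ) : EReal)) atTop (𝓝 (lowerDimension (F : Set X))) := by
  obtain ⟨e, he⟩ := exists_surjective_nat (ℚ × ℕ)
  have hpos : ∀ n : ℕ, (0 : ℝ) < 1 / ((n : ℝ) + 1) := fun n => Nat.one_div_pos_of_nat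
  refine exists_isBaireClass_one_tendsto (q := fun n => ((e n).1 : ℝ))
    (fun n => isClosed_hasLowerCoveringBound (X := X) ((e n).1 : ℝ)
      (1 / (((e n).2 : ℝ) + 1)) (1 / (((e n).2 : ℝ) + 1)))
    (fun F => lowerDimension_nonneg _) (fun n F hF => le_lowerDimension (hpos _) (hpos _) hF) ?_
  intro F b _ hbF
  obtain ⟨α, hbα, C, hC, ρ, hρ, h⟩ := exists_hasLowerCoveringBound_of_lt hbF
  obtain ⟨p, hbp, hpα⟩ := EReal.exists_rat_btwn_of_lt hbα
  -- A single `m` replaces both `C` and `ρ`, since shrinking either weakens the estimate.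
  obtain ⟨m, hm⟩ := exists_nat_one_div_lt (lt_min hC hρ)
  obtain ⟨n, hn⟩ := he (p, m)
  refine ⟨n, ?_, by simpa [hn] using hbp⟩
  simp only [hn, Set.mem_ofPred_eq]
  exact h.mono (by exact_mod_cast hpα.le) (hm.le.trans (min_le_left _ _)) hC.le
    (hm.le.trans (min_le_right _ _))

end LowerDimension

theorem theorem5p3 {X : Type*} [MetricSpace X] [CompactSpace X] [Nonempty X] :
    IsBaireClass 2 (fun F : NonemptyCompacts X => lowerDimension (F : Set X)) ∧
    ((∀ F : NonemptyCompacts X, lowerDimension (F : Set X) ≠ ⊤) →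
      IsBaireClass 2 (fun F : NonemptyCompacts X => (lowerDimension (F : Set X)).toReal)) := by
  obtain ⟨g, hg, hlim⟩ := exists_isBaireClass_one_tendsto_lowerDimension X
  refine ⟨⟨fun k F => (g k F : EReal), fun k => (hg k).continuous_comp continuous_coe_real_ereal,
    hlim⟩, fun hfin => ⟨g, hg, fun F => ?_⟩⟩
  have hbot : lowerDimension (F : Set X) ≠ ⊥ :=
    (EReal.bot_lt_zero.trans_le (lowerDimension_nonneg _)).ne'
  exact (EReal.tendsto_toReal (hfin F) hbot).comp (hlim F)
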